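/- Let $\mathcal V$ be a finite set of $n\ge 1$ nodes with a distinguished leader $\ell\in\mathcal V$, and let $S\in\{-,0,+\}^{\mathcal V\times\mathcal V}$ be a sign pattern, where $S_{ij}\neq 0$ means that there is a directed edge from $j$ to $i$ with sign $S_{ij}$. Assume that the network is input-connected: every node is reachable from $\ell$ along a directed walk. (No assumption is made on the signs; signed or layer dilations may occur.) Let $p\ge 2$ and let $t_0<t_1<\dots<t_p$ be arbitrary switching times. Then there are real matrices $A_1,\dots,A_p$, each having exactly the sign pattern $S$ (that is, $\operatorname{sign}(A_k)_{ij}=S_{ij}$ for all $i,j,k$), and an input vector $B=b_1e_\ell$ with $b_1>0$, such that the temporally switching system $$\dot x(t)=A_k x(t)+B\,u(t),\qquad t\in[t_{k-1},t_k),\quad k=1,\dots,p,$$ with continuous state $x$, is completely herdable on $[t_0,t_2]$, i.e. after only two snapshots: for every initial state $x(t_0)\in\mathbb R^{\mathcal V}$ and every $h>0$ there is a piecewise continuous input $u:[t_0,t_2]\to\mathbb R$ whose solution satisfies $x_i(t_2)\ge h$ simultaneously for all $i\in\mathcal V$. Moreover the same realization is completely herdable on $[t_0,t_k]$ for every $k$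 with $2\le k\le p$. In other words, the network with fixed sign pattern and topology is structurally sign ($\mathcal{SS}$) herdable within two snapshots. -/

import Mathlib

open Set Filter Topology
open scoped Matrix

/-- The directed graph of a sign pattern: `S i j ≠ 0` means that there is an edge from node `j`
to node `i`. -/
def IsEdge {V : Type*} (S : Matrix V V SignType) (j i : V) : Prop :=
  S i j ≠ 0

/-- The network with sign pattern `S` and leader `l` is input-connected: every node can be reached
from the leader (which receives the external input) along a directed walk. -/
def IsInputConnected {V : Type*} (S : Matrix V V SignType) (l : V) : Prop :=
  ∀ v, Relation.ReflTransGen (IsEdge S) l v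

/-- `(A₁, …, A_p; B)` is a realization of the signed structured matrices `(S₁, …, S_p; β)`:
every entry has the sign that is prescribed for it (a prescribed zero is a zero). -/
def IsRealization {V : Type*} {p : ℕ} (S : Fin p → Matrix V V SignType) (β : V → SignType)
    (A : Fin p → Matrix V V ℝ) (B : V → ℝ) : Prop :=
  (∀ k i j, SignType.sign (A k i j) = S k i j) ∧ ∀ i, SignType.sign (B i) = β i

/-- `u` is piecewise continuous on `[a, b]`: continuous up to finitely many points, with finite
one-sided limits everywhere. -/
def IsPiecewiseContinuousOn (u : ℝ → ℝ) (a b : ℝ) : Prop :=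
  (∃ F : Finset ℝ, ∀ s ∈ Icc a b, s ∉ F → ContinuousWithinAt u (Icc a b) s) ∧
  (∀ s ∈ Ioc a b, ∃ c, Tendsto u (𝓝[<] s) (𝓝 c)) ∧
  (∀ s ∈ Ico a b, ∃ c, Tendsto u (𝓝[>] s) (𝓝 c))

/-- `x` solves the temporally switching system with switching times `t 0 < t 1 < ⋯ < t p` on the
interval `[t 0, t k]`, with (piecewise continuous) input `u` and initial state `x₀`: it is
continuous, it starts at `x₀`, and during each snapshot `i` among the first `k` (the one that runs
from `t i.castSucc` to `t i.succ`) it satisfies `x' = A i x + B u` wherever `u` is continuous. -/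
def IsTrajectory {V : Type*} [Fintype V] {p : ℕ} (t : Fin (p + 1) → ℝ)
    (A : Fin p → Matrix V V ℝ) (B : V → ℝ) (k : Fin (p + 1))
    (u : ℝ → ℝ) (x₀ : V → ℝ) (x : ℝ → V → ℝ) : Prop :=
  ContinuousOn x (Icc (t 0) (t k)) ∧ x (t 0) = x₀ ∧
  ∀ i : Fin p, i.castSucc < k → ∀ s ∈ Ioo (t i.castSucc) (t i.succ), ContinuousAt u s →
    HasDerivAt x (A i *ᵥ x s + u s • B) s

/-- Complete herdability on `[t 0, t k]`, that is, by the end of the `k`-th snapshot: from every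
initial state and for every threshold `h > 0` some piecewise continuous input brings all nodes
simultaneously to states `≥ h` at time `t k`. -/
def IsCompletelyHerdable {V : Type*} [Fintype V] {p : ℕ} (t : Fin (p + 1) → ℝ)
    (A : Fin p → Matrix V V ℝ) (B : V → ℝ) (k : Fin (p + 1)) : Prop :=
  ∀ x₀ : V → ℝ, ∀ h : ℝ, 0 < h →
    ∃ u : ℝ → ℝ, IsPiecewiseContinuousOn u (t 0) (t k) ∧
      ∃ x : ℝ → V → ℝ, IsTrajectory t A B k u x₀ x ∧ ∀ i, h ≤ x (t k) i

/-- Structural sign herdability within `m` snapshots: some realization of the sign patterns is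
completely herdable on `[t 0, t m]`, and stays so on each longer interval `[t 0, t k]` up to the
whole interval `[t 0, t p]`. -/
def IsSSHerdableWithin {V : Type*} [Fintype V] {p : ℕ} (t : Fin (p + 1) → ℝ)
    (S : Fin p → Matrix V V SignType) (β : V → SignType) (m : ℕ) : Prop :=
  ∃ (A : Fin p → Matrix V V ℝ) (B : V → ℝ), IsRealization S β A B ∧
    ∀ k : Fin (p + 1), m ≤ (k : ℕ) → IsCompletelyHerdable t A B k

/-! ### Controllability of a single linear system: Krylov subspace, flow, steering. -/

section LinearControl

variable {E : Type*} [NormedAddCommGroup E] [NormedSpace ℝ E]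

/-! During one snapshot the input can add any Krylov vector to the free evolution
(`exists_input_of_mem_krylov`, `IsReachable.succ`). Scaling that vector by `m → ∞` overwhelms the
initial state, so herdability follows once some strictly positive direction can be added.

Such a direction comes from two snapshots. On a spanning tree rooted at the leader, edge weights can
be chosen so that `∑ L ^ k` sends a multiple of `e_l` to any nowhere-zero amplitude vector `c` whose
quotients along tree edges have the prescribed signs (`sum_treeMatrix_pow`). Two such vectors with
`c₀ - 2 c₁ = 1` exist (`exists_amplitudes`): one is produced in each snapshot.

The exact pattern `S` is restored by adding `ε` times its sign matrix. The second matrix is also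
multiplied by `ε`, and later ones are `ε` times the sign matrix. This keeps signs and Krylov
subspaces, while their flows tend to the identity. At `ε = 0` the combined direction is the all-ones
vector, so by continuity it is positive for small `ε > 0`. -/

/-- The Krylov (controllable) subspace of the pair `(L, b)`. -/
def krylov (L : E →L[ℝ] E) (b : E) : Submodule ℝ E :=
  Submodule.span ℝ (range fun k : ℕ => (L ^ k) b)

/-- The flow `exp (s L)` of the linear vector field `L`. -/
noncomputable def flow (L : E →L[ℝ] E) (s : ℝ) : E →L[ℝ] E :=
  NormedSpace.exp (s • L)

theorem flow_zero (L : E →L[ℝ] E) : flow L 0 = 1 := by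
  simp [flow]

variable [FiniteDimensional ℝ E]

theorem flow_add (L : E →L[ℝ] E) (s r : ℝ) : flow L (s + r) = flow L s * flow L r := by
  have : CompleteSpace E := FiniteDimensional.complete ℝ E
  let _ : NormedAlgebra ℚ (E →L[ℝ] E) := NormedAlgebra.restrictScalars ℚ ℝ _
  rw [flow, add_smul]
  exact NormedSpace.exp_add_of_commute
    ((Commute.refl L).smul_left s |>.smul_right r)

theorem flow_apply_flow (L : E →L[ℝ] E) (s r : ℝ) (x : E) :
    flow L s (flow L r x) = flow L (s + r) x := by
  rw [flow_add]; rfl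

theorem hasDerivAt_flow (L : E →L[ℝ] E) (s : ℝ) : HasDerivAt (flow L) (L * flow L s) s := by
  have : CompleteSpace E := FiniteDimensional.complete ℝ E
  exact hasDerivAt_exp_smul_const' L s

theorem continuous_flow (L : E →L[ℝ] E) : Continuous (flow L) :=
  continuous_iff_continuousAt.2 fun s => (hasDerivAt_flow L s).continuousAt

/-- Differentiating `f (flow L s b) = 0` repeatedly on the open interval produces the powers of `L`;
continuity then allows `s = 0`. -/
theorem pow_apply_eq_zero_of_flow (L : E →L[ℝ] E) (b : E) (f : E →L[ℝ] ℝ) {T : ℝ} (hT : 0 < T)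
    (h : ∀ s ∈ Ioo 0 T, f (flow L s b) = 0) (k : ℕ) : f ((L ^ k) b) = 0 := by
  have key : ∀ k : ℕ, ∀ s ∈ Ioo 0 T, f ((L ^ k) (flow L s b)) = 0 := by
    intro k
    induction k with
    | zero => simpa using h
    | succ k ih =>
      intro s hs
      have h1 : HasDerivAt (fun r => f ((L ^ k) (flow L r b))) (f ((L ^ k) (L (flow L s b)))) s :=
        (f.comp (L ^ k)).hasFDerivAt.comp_hasDerivAt s
          ((hasDerivAt_flow L s).clm_apply (hasDerivAt_const s b) |>.congr_deriv (by simp))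
      have h2 : HasDerivAt (fun r => f ((L ^ k) (flow L r b))) 0 s :=
        (hasDerivAt_const s (0 : ℝ)).congr_of_eventuallyEq
          (by filter_upwards [isOpen_Ioo.mem_nhds hs] with r hr using ih r hr)
      rw [pow_succ]
      exact h1.unique h2
  have hc : Continuous fun s => f ((L ^ k) (flow L s b)) :=
    (f.comp (L ^ k)).continuous.comp ((continuous_flow L).clm_apply continuous_const)
  have h0 : EqOn (fun s => f ((L ^ k) (flow L s b))) (fun _ => 0) (closure (Ioo 0 T)) :=
    EqOn.closure (fun s hs => key k s hs) hc continuous_const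
  rw [closure_Ioo hT.ne] at h0
  simpa [flow_zero] using h0 (left_mem_Icc.2 hT.le)

/-- The effect at time `c` of a continuous input applied from time `a` on. -/
noncomputable def inputResponse (L : E →L[ℝ] E) (b : E) (a c : ℝ) : C(ℝ, ℝ) →ₗ[ℝ] E where
  toFun u := ∫ r in a..c, u r • flow L (c - r) b
  map_add' u v := by
    have hc : Continuous fun r => flow L (c - r) b :=
      ((continuous_flow L).comp (by fun_prop : Continuous fun r : ℝ => c - r)).clm_apply
        continuous_const
    simp only [ContinuousMap.add_apply, add_smul]
    exact intervalIntegral.integral_add ((u.continuous.smul hc).intervalIntegrable _ _)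
      ((v.continuous.smul hc).intervalIntegrable _ _)
  map_smul' m u := by
    simp [mul_smul]

theorem krylov_le_range_inputResponse (L : E →L[ℝ] E) (b : E) {a c : ℝ} (hac : a < c) :
    krylov L b ≤ LinearMap.range (inputResponse L b a c) := by
  have : CompleteSpace E := FiniteDimensional.complete ℝ E
  intro v hv
  by_contra hn
  obtain ⟨f, hfv, hf⟩ := Submodule.exists_le_ker_of_notMem hn
  let g : E →L[ℝ] ℝ := LinearMap.toContinuousLinearMap f
  have hc : Continuous fun r => flow L (c - r) b :=
    ((continuous_flow L).comp (by fun_prop : Continuous fun r : ℝ => c - r)).clm_apply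
      continuous_const
  -- Testing an annihilator of the range on this input turns its value into the integral of `u ^ 2`,
  -- which forces `u = 0`.
  let u : C(ℝ, ℝ) := ⟨fun r => g (flow L (c - r) b), g.continuous.comp hc⟩
  have hu : ∫ r in a..c, u r * u r = 0 := by
    have h1 : g (inputResponse L b a c u) = 0 := hf ⟨u, rfl⟩
    change g (∫ r in a..c, u r • flow L (c - r) b) = 0 at h1
    have hi : Continuous fun r => u r • flow L (c - r) b := u.continuous.smul hc
    rw [← ContinuousLinearMap.intervalIntegral_comp_comm _ (hi.intervalIntegrable _ _)] at h1
    simpa [u] using h1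
  have hz : ∀ r ∈ Icc a c, u r = 0 := by
    intro r hr
    by_contra hne
    have := intervalIntegral.integral_pos hac
      (u.continuous.mul u.continuous).continuousOn (fun s _ => mul_self_nonneg (u s))
      ⟨r, hr, mul_self_pos.2 hne⟩
    exact this.ne' hu
  have hk := pow_apply_eq_zero_of_flow L b g (sub_pos.2 hac) (fun s hs => by
    have := hz (c - s) ⟨by linarith [hs.2], by linarith [hs.1]⟩
    simpa [u] using this)
  have hle : krylov L b ≤ LinearMap.ker f := by
    rw [krylov, Submodule.span_le]
    rintro _ ⟨k, rfl⟩
    exact hk k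
  exact hfv (hle hv)

/-- **Controllability on the Krylov subspace**: the forced linear system can be steered from `x₀`
to its free evolution shifted by any vector of the Krylov subspace. -/
theorem exists_input_of_mem_krylov (L : E →L[ℝ] E) (b : E) {a c : ℝ} (hac : a < c) (x₀ : E)
    {v : E} (hv : v ∈ krylov L b) :
    ∃ (u : ℝ → ℝ) (x : ℝ → E), Continuous u ∧ (∀ s, HasDerivAt x (L (x s) + u s • b) s) ∧
      x a = x₀ ∧ x c = flow L (c - a) x₀ + v := by
  have : CompleteSpace E := FiniteDimensional.complete ℝ E
  obtain ⟨u, rfl⟩ := krylov_le_range_inputResponse L b hac hv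
  have hc : Continuous fun r => u r • flow L (-r) b :=
    u.continuous.smul (((continuous_flow L).comp continuous_neg).clm_apply continuous_const)
  -- Variation of constants, with `flow L s` factored out of the integral.
  refine ⟨u, fun s => flow L s (flow L (-a) x₀ + ∫ r in a..s, u r • flow L (-r) b),
    u.continuous, fun s => ?_, ?_, ?_⟩
  · have h1 := (hasDerivAt_flow L s).clm_apply
      ((hc.integral_hasStrictDerivAt a s).hasDerivAt.const_add (flow L (-a) x₀))
    refine h1.congr_deriv ?_
    rw [map_smul, flow_apply_flow, add_neg_cancel, flow_zero]
    rfl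
  · simp [flow_apply_flow, flow_zero]
  · change flow L c _ = _ + ∫ r in a..c, u r • flow L (c - r) b
    rw [map_add, flow_apply_flow, ← sub_eq_add_neg,
      ← ContinuousLinearMap.intervalIntegral_comp_comm _ (hc.intervalIntegrable _ _)]
    simp only [map_smul, flow_apply_flow, sub_eq_add_neg]

end LinearControl

/-! ### Concatenation of inputs and reachability across snapshots. -/

theorem IsPiecewiseContinuousOn.ite_lt {u v : ℝ → ℝ} {a b c : ℝ}
    (hu : IsPiecewiseContinuousOn u a b) (hv : Continuous v) :
    IsPiecewiseContinuousOn (fun s => if s < b then u s else v s) a c := by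
  obtain ⟨⟨F, hF⟩, hl, hr⟩ := hu
  have hlt : ∀ {s}, s < b → (fun s => if s < b then u s else v s) =ᶠ[𝓝 s] u := fun hs => by
    filter_upwards [Iio_mem_nhds hs] with r hr using if_pos hr
  have hgt : ∀ {s}, b < s → (fun s => if s < b then u s else v s) =ᶠ[𝓝 s] v := fun hs => by
    filter_upwards [Ioi_mem_nhds hs] with r hr using if_neg (not_lt.2 (le_of_lt hr))
  refine ⟨⟨insert b F, fun s hs hsF => ?_⟩, fun s hs => ?_, fun s hs => ?_⟩
  · rw [Finset.mem_insert, not_or] at hsF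
    rcases lt_or_gt_of_ne hsF.1 with h | h
    · refine ContinuousWithinAt.congr_of_eventuallyEq ?_ ((hlt h).filter_mono nhdsWithin_le_nhds)
        (hlt h).eq_of_nhds
      refine (hF s ⟨hs.1, h.le⟩ hsF.2).mono_of_mem_nhdsWithin ?_
      filter_upwards [self_mem_nhdsWithin, mem_nhdsWithin_of_mem_nhds (Iio_mem_nhds h)]
        with r hr hrb using ⟨hr.1, le_of_lt hrb⟩
    · exact (hv.continuousAt.congr (hgt h).symm).continuousWithinAt
  · rcases le_or_gt s b with h | h
    · obtain ⟨y, hy⟩ := hl s ⟨hs.1, h⟩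
      refine ⟨y, hy.congr' ?_⟩
      filter_upwards [self_mem_nhdsWithin] with r hr using (if_pos (lt_of_lt_of_le hr h)).symm
    · exact ⟨v s, ((hv.continuousAt.congr (hgt h).symm).tendsto.mono_left
        nhdsWithin_le_nhds).trans (by rw [(hgt h).eq_of_nhds])⟩
  · rcases lt_or_ge s b with h | h
    · obtain ⟨y, hy⟩ := hr s ⟨hs.1, h⟩
      exact ⟨y, hy.congr' ((hlt h).symm.filter_mono nhdsWithin_le_nhds)⟩
    · refine ⟨v s, (hv.continuousAt.tendsto.mono_left nhdsWithin_le_nhds).congr' ?_⟩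
      filter_upwards [self_mem_nhdsWithin] with r hr
        using (if_neg (not_lt.2 (h.trans (le_of_lt hr)))).symm

section Reachability

variable {V : Type*} [Fintype V] {p : ℕ}

/-- A matrix as a continuous linear map on `V → ℝ`. -/
noncomputable def matrixCLM (A : Matrix V V ℝ) : (V → ℝ) →L[ℝ] (V → ℝ) :=
  LinearMap.toContinuousLinearMap A.mulVecLin

@[simp] theorem matrixCLM_apply (A : Matrix V V ℝ) (x : V → ℝ) : matrixCLM A x = A *ᵥ x := rfl

/-- The state `y` can be reached from `x₀` by the end of the `k`-th snapshot. -/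
def IsReachable (t : Fin (p + 1) → ℝ) (A : Fin p → Matrix V V ℝ) (B : V → ℝ) (k : Fin (p + 1))
    (x₀ y : V → ℝ) : Prop :=
  ∃ u : ℝ → ℝ, IsPiecewiseContinuousOn u (t 0) (t k) ∧
    ∃ x : ℝ → V → ℝ, IsTrajectory t A B k u x₀ x ∧ x (t k) = y

theorem isReachable_zero (t : Fin (p + 1) → ℝ) (A : Fin p → Matrix V V ℝ) (B x₀ : V → ℝ) :
    IsReachable t A B 0 x₀ x₀ := by
  refine ⟨0, ⟨⟨∅, fun s _ _ => continuousWithinAt_const⟩, fun s _ => ⟨0, tendsto_const_nhds⟩,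
    fun s _ => ⟨0, tendsto_const_nhds⟩⟩, fun _ => x₀, ⟨continuousOn_const, rfl, ?_⟩, rfl⟩
  intro i hi
  exact absurd hi (Fin.not_lt_zero _)

/-- Trajectories are glued at the switching time: the old one before it, a steered solution with
matrix `A k` from it on. -/
theorem IsReachable.succ {t : Fin (p + 1) → ℝ} (ht : StrictMono t) {A : Fin p → Matrix V V ℝ}
    {B : V → ℝ} {k : Fin p} {x₀ y : V → ℝ} (h : IsReachable t A B k.castSucc x₀ y)
    {v : V → ℝ} (hv : v ∈ krylov (matrixCLM (A k)) B) :
    IsReachable t A B k.succ x₀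
      (flow (matrixCLM (A k)) (t k.succ - t k.castSucc) y + v) := by
  obtain ⟨u, hu, x, ⟨hxc, hx0, hxd⟩, hxk⟩ := h
  have hlt : t k.castSucc < t k.succ := ht Fin.castSucc_lt_succ
  obtain ⟨w, z, hw, hz, hza, hzc⟩ := exists_input_of_mem_krylov (matrixCLM (A k)) B hlt y hv
  have hzcont : Continuous z := continuous_iff_continuousAt.2 fun s => (hz s).continuousAt
  have h0 : t 0 ≤ t k.castSucc := ht.monotone (Fin.zero_le _)
  have heq : x (t k.castSucc) = z (t k.castSucc) := hxk.trans hza.symm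
  refine ⟨_, hu.ite_lt hw, fun s => if s < t k.castSucc then x s else z s,
    ⟨?_, ?_, ?_⟩, ?_⟩
  · have h1 : ContinuousOn (fun s => if s < t k.castSucc then x s else z s)
        (Icc (t 0) (t k.castSucc)) := by
      refine hxc.congr fun s hs => ?_
      rcases hs.2.lt_or_eq with h | h
      · exact if_pos h
      · subst h; simp [heq]
    have h2 : ContinuousOn (fun s => if s < t k.castSucc then x s else z s)
        (Icc (t k.castSucc) (t k.succ)) :=
      hzcont.continuousOn.congr fun s hs => if_neg (not_lt.2 hs.1)
    rw [← Icc_union_Icc_eq_Icc h0 hlt.le]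
    exact h1.union_of_isClosed h2 isClosed_Icc isClosed_Icc
  · rcases h0.lt_or_eq with h | h
    · simpa [h] using hx0
    · simp only [h, lt_irrefl, if_false]
      rw [← heq, ← h, hx0]
  · intro i hi s hs hus
    rcases (Fin.castSucc_lt_succ_iff.1 hi).lt_or_eq with hik | rfl
    · have hsk : s < t k.castSucc := hs.2.trans_le (ht.monotone (Fin.le_castSucc_iff.2
        (Fin.succ_lt_succ_iff.2 hik)))
      have hev := Iio_mem_nhds hsk
      have hus' : ContinuousAt u s := hus.congr (by
        filter_upwards [hev] with r hr using if_pos hr)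
      simp only [if_pos hsk]
      exact (hxd i (Fin.castSucc_lt_castSucc_iff.2 hik) s hs hus').congr_of_eventuallyEq (by
        filter_upwards [hev] with r hr using if_pos hr)
    · have hns : ¬ s < t i.castSucc := not_lt.2 hs.1.le
      simp only [if_neg hns]
      exact (hz s).congr_of_eventuallyEq (by
        filter_upwards [Ioi_mem_nhds hs.1] with r hr using if_neg (not_lt.2 (le_of_lt hr)))
  · simp only [if_neg (not_lt.2 hlt.le)]
    exact hzc

end Reachability

/-! ### Effect of rescaling and perturbing the matrix. -/

section Rescaling

variable {E : Type*} [NormedAddCommGroup E] [NormedSpace ℝ E]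

/-- Each generator changes only by the nonzero factor `ε ^ k`. The flow can thus be slowed towards
the identity without losing controllable directions. -/
theorem krylov_le_krylov_smul (L : E →L[ℝ] E) (b : E) {ε : ℝ} (hε : ε ≠ 0) :
    krylov L b ≤ krylov (ε • L) b := by
  rw [krylov, Submodule.span_le]
  rintro _ ⟨k, rfl⟩
  have h : (L ^ k) b = (ε ^ k)⁻¹ • ((ε • L) ^ k) b := by
    rw [smul_pow, smul_apply, inv_smul_smul₀ (pow_ne_zero k hε)]
  simp only [SetLike.mem_coe]
  rw [h]
  exact Submodule.smul_mem _ _ (Submodule.subset_span ⟨k, rfl⟩)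

theorem sum_pow_apply_mem_krylov (L : E →L[ℝ] E) (b : E) (m : ℝ) (N : ℕ) :
    ∑ k ∈ Finset.range N, (L ^ k) (m • b) ∈ krylov L b := by
  refine Submodule.sum_mem _ fun k _ => ?_
  rw [map_smul]
  exact Submodule.smul_mem _ _ (Submodule.subset_span ⟨k, rfl⟩)

theorem continuous_flow_comp [FiniteDimensional ℝ E] {X : Type*} [TopologicalSpace X]
    {L : X → E →L[ℝ] E} (hL : Continuous L) (s : ℝ) : Continuous fun x => flow (L x) s := by
  have : CompleteSpace E := FiniteDimensional.complete ℝ E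
  let _ : NormedAlgebra ℚ (E →L[ℝ] E) := NormedAlgebra.restrictScalars ℚ ℝ _
  exact NormedSpace.exp_continuous.comp (hL.const_smul s)

end Rescaling

/-! ### Spanning trees, node signs and weighted tree matrices. -/

section Arborescence

variable {V : Type*}

/-- There is a directed walk with `n` edges from `l` to the given node. -/
def HasWalk (S : Matrix V V SignType) (l : V) : ℕ → V → Prop
  | 0, v => v = l
  | n + 1, v => ∃ w, HasWalk S l n w ∧ IsEdge S w v

theorem IsInputConnected.exists_hasWalk {S : Matrix V V SignType} {l : V}
    (hS : IsInputConnected S l) (v : V) : ∃ n, HasWalk S l n v := by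
  induction hS v with
  | refl => exact ⟨0, rfl⟩
  | tail _ hbc ih => exact ih.imp' Nat.succ fun n hn => ⟨_, hn, hbc⟩

/-- A breadth-first spanning tree of an input-connected network, with the depth of its nodes. -/
theorem IsInputConnected.exists_depth_parent {S : Matrix V V SignType} {l : V}
    (hS : IsInputConnected S l) :
    ∃ (d : V → ℕ) (π : V → V), d l = 0 ∧ ∀ v, v ≠ l → d v = d (π v) + 1 ∧ S v (π v) ≠ 0 := by
  classical
  let d : V → ℕ := fun v => Nat.find (hS.exists_hasWalk v)
  have hd : ∀ v, HasWalk S l (d v) v := fun v => Nat.find_spec (hS.exists_hasWalk v)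
  have hmin : ∀ v n, HasWalk S l n v → d v ≤ n := fun v n => Nat.find_min' (hS.exists_hasWalk v)
  have hex : ∀ v, ∃ w, v ≠ l → d v = d w + 1 ∧ S v w ≠ 0 := by
    intro v
    have hv := hd v
    rcases hn : d v with _ | n
    · rw [hn] at hv
      exact ⟨v, fun h => absurd hv h⟩
    · rw [hn] at hv
      obtain ⟨w, hw, hwv⟩ := hv
      -- The two minimality bounds give `d w ≤ n` and `n + 1 ≤ d w + 1`, hence equality.
      have h1 := hmin w n hw
      have h2 := hmin v (d w + 1) ⟨w, hd w, hwv⟩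
      exact ⟨w, fun _ => ⟨by omega, hwv⟩⟩
  choose π hπ using hex
  exact ⟨d, π, Nat.le_zero.1 (hmin l 0 rfl), hπ⟩

/-- The nodes can be signed in such a way that each edge from a parent carries the quotient
of the signs of its ends. -/
theorem exists_node_sign {S : Matrix V V SignType} {l : V} {d : V → ℕ} {π : V → V} (hl : d l = 0)
    (h : ∀ v, v ≠ l → d v = d (π v) + 1 ∧ S v (π v) ≠ 0) :
    ∃ σ : V → SignType, (∀ v, σ v ≠ 0) ∧ ∀ v, v ≠ l → S v (π v) = σ v * σ (π v) := by
  -- `τ n v` is the product of the signs of the first `n` edges met when climbing from `v` through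
  -- its parents; at `n = d v` the climb ends at the root.
  let τ : ℕ → V → SignType := fun n => Nat.rec (fun _ => 1) (fun _ f v => S v (π v) * f (π v)) n
  have hrec : ∀ v, v ≠ l → τ (d v) v = S v (π v) * τ (d (π v)) (π v) := fun v hv => by
    rw [(h v hv).1]
  have hne : ∀ n v, d v = n → τ n v ≠ 0 := by
    intro n
    induction n with
    | zero => intro v _; exact one_ne_zero
    | succ n ih =>
      intro v hv
      have hvl : v ≠ l := by rintro rfl; omega
      exact mul_ne_zero (h v hvl).2 (ih (π v) (by have := (h v hvl).1; omega))
  refine ⟨fun v => τ (d v) v, fun v => hne _ v rfl, fun v hv => ?_⟩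
  have h1 : ∀ a b : SignType, b ≠ 0 → a = a * b * b := by decide
  simp only [hrec v hv]
  exact h1 _ _ (hne _ _ rfl)

/-- The matrix with entries `±1` and `0` of a sign pattern. -/
def signMatrix (S : Matrix V V SignType) : Matrix V V ℝ := fun i j => (S i j : ℝ)

theorem sign_smul_signMatrix (S : Matrix V V SignType) {ε : ℝ} (hε : 0 < ε) (i j : V) :
    SignType.sign ((ε • signMatrix S) i j) = S i j := by
  simp only [Matrix.smul_apply, signMatrix, smul_eq_mul]
  rcases S i j with _ | _ | _ <;> simp [hε, sign_pos]

variable [DecidableEq V]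

/-- The weighted adjacency matrix of the tree with root `l` and parent map `π` for which a unit
state at the root spreads with the amplitudes `c`. -/
noncomputable def treeMatrix (l : V) (π : V → V) (c : V → ℝ) : Matrix V V ℝ :=
  fun v w => if v ≠ l ∧ w = π v then c v / c w else 0

/-- On a tree edge both summands have the sign `S i j`, so they cannot cancel; elsewhere only the
perturbation contributes. -/
theorem sign_treeMatrix_add_smul (S : Matrix V V SignType) {l : V} {π : V → V} {c : V → ℝ}
    (hc : ∀ v, v ≠ l → SignType.sign (c v / c (π v)) = S v (π v)) {ε : ℝ} (hε : 0 < ε) (i j : V) :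
    SignType.sign ((treeMatrix l π c + ε • signMatrix S) i j) = S i j := by
  have h := sign_smul_signMatrix S hε i j
  rw [Matrix.add_apply, treeMatrix]
  split_ifs with hij
  · obtain ⟨hi, rfl⟩ := hij
    have h' := hc i hi
    rcases lt_trichotomy (c i / c (π i)) 0 with h0 | h0 | h0
    · rw [sign_neg h0] at h'
      rw [← h', sign_eq_neg_one_iff] at h
      rw [← h', sign_neg (add_neg h0 h)]
    · rw [h0, zero_add, h]
    · rw [sign_pos h0] at h'
      rw [← h', sign_eq_one_iff] at h
      rw [← h', sign_pos (add_pos h0 h)]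
  · rw [zero_add, h]

variable [Fintype V]

theorem treeMatrix_mulVec (l : V) (π : V → V) (c x : V → ℝ) (v : V) :
    (treeMatrix l π c *ᵥ x) v = if v = l then 0 else c v / c (π v) * x (π v) := by
  by_cases hv : v = l <;> simp [Matrix.mulVec, dotProduct, treeMatrix, hv]

/-- Each application moves the signal down one level of the tree, and the weights `c v / c (π v)`
telescope along the path from the root. -/
theorem treeMatrix_pow_apply {l : V} {d : V → ℕ} {π : V → V} {c : V → ℝ} (hl : d l = 0)
    (hd : ∀ v, v ≠ l → d v = d (π v) + 1) (hc : ∀ v, c v ≠ 0) (k : ℕ) (v : V) :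
    ((matrixCLM (treeMatrix l π c) ^ k) (Pi.single l (c l))) v = if d v = k then c v else 0 := by
  induction k generalizing v with
  | zero =>
    rcases eq_or_ne v l with rfl | hv
    · simp [hl]
    · simp [hd v hv, hv]
  | succ k ih =>
    rw [pow_succ', mul_apply_eq_comp, matrixCLM_apply, treeMatrix_mulVec, ih]
    rcases eq_or_ne v l with rfl | hv
    · simp [hl]
    · have := hc (π v)
      simp only [hv, hd v hv, if_false, add_left_inj]
      split_ifs <;> simp [this]

theorem sum_treeMatrix_pow {l : V} {d : V → ℕ} {π : V → V} {c : V → ℝ} (hl : d l = 0)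
    (hd : ∀ v, v ≠ l → d v = d (π v) + 1) (hc : ∀ v, c v ≠ 0) {N : ℕ} (hN : ∀ v, d v < N) :
    ∑ k ∈ Finset.range N, (matrixCLM (treeMatrix l π c) ^ k) (Pi.single l (c l)) = c := by
  ext v
  rw [Finset.sum_apply]
  simp [treeMatrix_pow_apply hl hd hc, hN v]

end Arborescence

/-! ### Amplitudes, reachable lines and herdability. -/

section Herdability

variable {V : Type*}

/-- Two weightings of a spanning tree whose amplitudes combine to the all-ones vector. -/
theorem exists_amplitudes {S : Matrix V V SignType} {l : V} (hS : IsInputConnected S l) :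
    ∃ (d : V → ℕ) (π : V → V) (c₀ c₁ : V → ℝ), d l = 0 ∧ (∀ v, v ≠ l → d v = d (π v) + 1) ∧
      (∀ v, c₀ v ≠ 0) ∧ (∀ v, c₁ v ≠ 0) ∧
      (∀ v, v ≠ l → SignType.sign (c₀ v / c₀ (π v)) = S v (π v)) ∧
      (∀ v, v ≠ l → SignType.sign (c₁ v / c₁ (π v)) = S v (π v)) ∧ ∀ v, c₀ v - 2 * c₁ v = 1 := by
  obtain ⟨d, π, hl, h⟩ := hS.exists_depth_parent
  obtain ⟨σ, hσ, hσS⟩ := exists_node_sign hl h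
  -- The amplitudes are `c₀ = 3, c₁ = 1` at positive nodes and `c₀ = c₁ = -1` at negative ones: `3 -
  -- 2 * 1 = -1 - 2 * (-1) = 1`.
  let f : SignType → ℝ := fun s => if s = 1 then 3 else -1
  have hf : ∀ s, s ≠ 0 → SignType.sign (f s) = s := by
    intro s hs
    rcases s with _ | _ | _
    · exact absurd rfl hs
    · exact sign_neg (by norm_num [f])
    · exact sign_pos (by norm_num [f])
  have hf' : ∀ s, s ≠ 0 → f s - 2 * (s : ℝ) = 1 := by
    intro s hs
    rcases s with _ | _ | _
    · exact absurd rfl hs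
    · norm_num [f]
    · norm_num [f]
  have hg : ∀ s : SignType, SignType.sign (s : ℝ) = s := by
    intro s; rcases s with _ | _ | _ <;> simp
  have hquot : ∀ c : V → ℝ, (∀ v, SignType.sign (c v) = σ v) →
      (∀ v, c v ≠ 0) ∧ ∀ v, v ≠ l → SignType.sign (c v / c (π v)) = S v (π v) := by
    intro c hc
    refine ⟨fun v h0 => hσ v ?_, fun v hv => ?_⟩
    · rw [← hc v, h0, sign_zero]
    · have hinv : SignType.sign (c (π v))⁻¹ = SignType.sign (c (π v)) := by
        rcases lt_trichotomy (c (π v)) 0 with h0 | h0 | h0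
        · rw [sign_neg h0, sign_neg (inv_lt_zero.2 h0)]
        · rw [h0, inv_zero]
        · rw [sign_pos h0, sign_pos (inv_pos.2 h0)]
      rw [div_eq_mul_inv, sign_mul, hinv, hc, hc, hσS v hv]
  have q₀ := hquot (fun v => f (σ v)) fun v => hf _ (hσ v)
  have q₁ := hquot (fun v => (σ v : ℝ)) fun v => hg _
  exact ⟨d, π, _, _, hl, fun v hv => (h v hv).1, q₀.1, q₁.1, q₀.2, q₁.2, fun v => hf' _ (hσ v)⟩

variable [Fintype V]

/-- If the snapshots after the second one have a common matrix, then the states that are reached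
from `x₀` contain a line in the direction of the freely propagated controllable vectors of the
first two snapshots. -/
theorem exists_forall_isReachable {p : ℕ} {t : Fin (p + 1) → ℝ} (ht : StrictMono t)
    (M : ℕ → Matrix V V ℝ) (hM : ∀ k, 2 ≤ k → M k = M 2) (B : V → ℝ) {v₀ v₁ : V → ℝ}
    (h₀ : v₀ ∈ krylov (matrixCLM (M 0)) B) (h₁ : v₁ ∈ krylov (matrixCLM (M 1)) B)
    (h2 : 2 < p + 1) (x₀ : V → ℝ) (k : ℕ) (hk : 2 ≤ k) (hkp : k < p + 1) :
    ∃ z : V → ℝ, ∀ m : ℝ, IsReachable t (fun i => M i) B ⟨k, hkp⟩ x₀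
      (z + m • flow (matrixCLM (M 2)) (t ⟨k, hkp⟩ - t ⟨2, h2⟩)
        (flow (matrixCLM (M 1)) (t ⟨2, h2⟩ - t ⟨1, by omega⟩) v₀ + v₁)) := by
  induction k, hk using Nat.le_induction with
  | base =>
    refine ⟨flow (matrixCLM (M 1)) (t ⟨2, h2⟩ - t ⟨1, by omega⟩)
      (flow (matrixCLM (M 0)) (t ⟨1, by omega⟩ - t 0) x₀), fun m => ?_⟩
    -- Both snapshots use the same multiplier `m`, so the reached state is affine in `m`. The flow
    -- of `M 0` acts only on `x₀` and enters only the offset `z`.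
    have r1 := (isReachable_zero t (fun i => M i) B x₀).succ ht (k := ⟨0, by omega⟩)
      (Submodule.smul_mem _ m h₀)
    have r2 := IsReachable.succ (k := ⟨1, by omega⟩) ht r1 (Submodule.smul_mem _ m h₁)
    refine (congrArg (IsReachable t (fun i => M i) B ⟨2, h2⟩ x₀) ?_).mpr r2
    change _ = flow (matrixCLM (M 1)) (t ⟨2, h2⟩ - t ⟨1, by omega⟩)
      (flow (matrixCLM (M 0)) (t ⟨1, by omega⟩ - t 0) x₀ + m • v₀) + m • v₁
    simp only [sub_self, flow_zero, one_apply_eq_self, map_add, map_smul, smul_add, add_assoc]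
  | succ k hk ih =>
    obtain ⟨z, hz⟩ := ih (by omega)
    refine ⟨flow (matrixCLM (M k)) (t ⟨k + 1, hkp⟩ - t ⟨k, by omega⟩) z, fun m => ?_⟩
    -- Later snapshots add the zero Krylov vector; their flows merge into one because they share a
    -- matrix.
    have r := IsReachable.succ (k := ⟨k, by omega⟩) ht (hz m) (Submodule.zero_mem _)
    refine (congrArg (IsReachable t (fun i => M i) B ⟨k + 1, hkp⟩ x₀) ?_).mpr r
    change _ = flow (matrixCLM (M k)) (t ⟨k + 1, hkp⟩ - t ⟨k, by omega⟩) _ + 0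
    rw [add_zero, map_add _ z, map_smul, hM k hk, flow_apply_flow, sub_add_sub_cancel]

/-- A realization is completely herdable as soon as a line in a positive direction is reachable
from each initial state. -/
theorem isCompletelyHerdable_of_isReachable {p : ℕ} {t : Fin (p + 1) → ℝ}
    {A : Fin p → Matrix V V ℝ} {B : V → ℝ} {k : Fin (p + 1)} {w : V → ℝ} (hw : ∀ i, 0 < w i)
    (h : ∀ x₀, ∃ z : V → ℝ, ∀ m : ℝ, IsReachable t A B k x₀ (z + m • w)) :
    IsCompletelyHerdable t A B k := by
  intro x₀ η _
  obtain ⟨z, hz⟩ := h x₀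
  have hev : ∀ᶠ m : ℝ in atTop, ∀ i, η ≤ z i + m * w i :=
    eventually_all.2 fun i =>
      (tendsto_atTop_add_const_left _ (z i) (tendsto_id.atTop_mul_const (hw i))).eventually_ge_atTop
        η
  obtain ⟨m, hm⟩ := hev.exists
  obtain ⟨u, hu, x, hx, hxk⟩ := hz m
  exact ⟨u, hu, x, hx, fun i => by rw [hxk]; exact hm i⟩

theorem continuous_matrixCLM :
    Continuous (matrixCLM : Matrix V V ℝ → (V → ℝ) →L[ℝ] (V → ℝ)) :=
  ((LinearMap.toContinuousLinearMap (𝕜 := ℝ) (E := V → ℝ) (F' := V → ℝ)).toLinearMap.comp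
    (Matrix.mulVecBilin ℝ ℝ : Matrix V V ℝ →ₗ[ℝ] (V → ℝ) →ₗ[ℝ] (V → ℝ))).continuous_of_finiteDimensional

theorem matrixCLM_smul (ε : ℝ) (A : Matrix V V ℝ) : matrixCLM (ε • A) = ε • matrixCLM A := by
  ext x : 1
  simp [Matrix.smul_mulVec]

end Herdability

/-! ### Choice of the realization. -/

theorem mainTheorem3 {V : Type*} [Fintype V] [DecidableEq V] (l : V)
    (S : Matrix V V SignType) (hS : IsInputConnected S l)
    (p : ℕ) (hp : 2 ≤ p) (t : Fin (p + 1) → ℝ) (ht : StrictMono t) :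
    IsSSHerdableWithin t (fun _ => S) (Pi.single l 1) 2 := by
  obtain ⟨d, π, c₀, c₁, hl, hd, hc₀, hc₁, hs₀, hs₁, hsum⟩ := exists_amplitudes hS
  have h2 : 2 < p + 1 := by omega
  obtain ⟨N, hN⟩ : ∃ N, ∀ v, d v < N :=
    ⟨Finset.univ.sup d + 1, fun v => Nat.lt_succ_of_le (Finset.le_sup (Finset.mem_univ v))⟩
  let A : (V → ℝ) → ℝ → Matrix V V ℝ := fun c ε => treeMatrix l π c + ε • signMatrix S
  let X : (V → ℝ) → ℝ → V → ℝ := fun c ε =>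
    ∑ k ∈ Finset.range N, (matrixCLM (A c ε) ^ k) (c l • Pi.single l 1)
  have hA : ∀ c, Continuous (A c) := fun c => by fun_prop
  have hX : ∀ c, Continuous (X c) := fun c => continuous_finsetSum _ fun k _ =>
    ((continuous_matrixCLM.comp (hA c)).pow k).clm_apply continuous_const
  have hX0 : ∀ c : V → ℝ, (∀ v, c v ≠ 0) → X c 0 = c := fun c hc => by
    have h := sum_treeMatrix_pow hl hd hc hN
    rw [← mul_one (c l), ← smul_eq_mul, Pi.single_smul'] at h
    simpa [X, A] using h
  -- The direction available at time `t k`; the factor `-2` is the one in `c₀ - 2 c₁ = 1`.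
  let w : Fin (p + 1) → ℝ → V → ℝ := fun k ε =>
    flow (matrixCLM (ε • signMatrix S)) (t k - t ⟨2, h2⟩)
      (flow (matrixCLM (ε • A c₁ ε)) (t ⟨2, h2⟩ - t ⟨1, by omega⟩) (X c₀ ε) + (-2 : ℝ) • X c₁ ε)
  have hw : ∀ k, Continuous (w k) := fun k =>
    (continuous_flow_comp (continuous_matrixCLM.comp (by fun_prop)) _).clm_apply
      (((continuous_flow_comp (continuous_matrixCLM.comp (continuous_id.smul (hA c₁))) _).clm_apply
        (hX c₀)).add ((continuous_const_smul (-2 : ℝ)).comp (hX c₁)))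
  have hw0 : ∀ k i, w k 0 i = 1 := fun k i => by
    have hz : ∀ s, flow (matrixCLM (0 : Matrix V V ℝ)) s = 1 := fun s => by
      rw [← zero_smul ℝ (0 : Matrix V V ℝ), matrixCLM_smul, zero_smul, flow, smul_zero,
        NormedSpace.exp_zero]
    simp only [w, zero_smul, hz, hX0 c₀ hc₀, hX0 c₁ hc₁, one_apply_eq_self]
    rw [← hsum i]
    simp [sub_eq_add_neg]
  -- There are finitely many pairs `(k, i)`, so a single `ε` serves all end times and all nodes.
  have hev : ∀ᶠ ε in 𝓝 (0 : ℝ), ∀ k i, 0 < w k ε i :=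
    eventually_all.2 fun k => eventually_all.2 fun i =>
      ((continuous_apply i).comp (hw k)).continuousAt.eventually_const_lt
        (by simp [hw0 k i])
  have hev' : ∀ᶠ ε in 𝓝[>] (0 : ℝ), ∀ k i, 0 < w k ε i := hev.filter_mono nhdsWithin_le_nhds
  have hev₀ : ∀ᶠ ε in 𝓝[>] (0 : ℝ), 0 < ε := self_mem_nhdsWithin
  obtain ⟨ε, hpos, hε⟩ := (hev'.and hev₀).exists
  -- The first matrix needs no factor `ε`, since its flow does not enter `w`.
  let M : ℕ → Matrix V V ℝ := fun k =>
    if k = 0 then A c₀ ε else if k = 1 then ε • A c₁ ε else ε • signMatrix S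
  refine ⟨fun i => M i, Pi.single l 1, ⟨fun k i j => ?_, fun i => ?_⟩, fun k hk => ?_⟩
  · simp only [M]
    split_ifs
    · exact sign_treeMatrix_add_smul S hs₀ hε i j
    · rw [Matrix.smul_apply, smul_eq_mul, sign_mul, sign_pos hε, one_mul]
      exact sign_treeMatrix_add_smul S hs₁ hε i j
    · exact sign_smul_signMatrix S hε i j
  · rcases eq_or_ne i l with rfl | hi
    · simp
    · simp [hi]
  · refine isCompletelyHerdable_of_isReachable (hpos k) fun x₀ => ?_
    refine exists_forall_isReachable ht M (fun k hk => ?_) (Pi.single l 1)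
      (v₀ := X c₀ ε) (v₁ := (-2 : ℝ) • X c₁ ε) ?_ ?_ h2 x₀ k hk k.2
    · have h0 : k ≠ 0 := by omega
      have h1 : k ≠ 1 := by omega
      simp [M, h0, h1]
    · exact sum_pow_apply_mem_krylov _ _ _ _
    · refine Submodule.smul_mem _ _ ?_
      change _ ∈ krylov (matrixCLM (ε • A c₁ ε)) _
      rw [matrixCLM_smul]
      exact krylov_le_krylov_smul _ _ hε.ne' (sum_pow_apply_mem_krylov _ _ _ _)
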